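/- Let $X$ be a real Banach space with dual $X^*$, and let $ck(X)$ be the family of all nonempty compact convex subsets of $X$, with $A+B=\{a+b: a\in A,\ b\in B\}$ and $-A=\{-a: a\in A\}$. For $C\in ck(X)$ let $s(x^*,C)=\sup\{\langle x^*,c\rangle : c\in C\}$, $x^*\in X^*$, be its support function. The bw*-topology on $X^*$ is the strongest topology that coincides with the weak* topology on every ball $\{x^*\in X^*:\|x^*\|\le r\}$. For $A,B\in ck(X)$, the generalized Hukuhara difference $A\ominus_g B$, when it exists, is the (necessarily unique) set $C\in ck(X)$ such that $$\text{(i)}\quad A=B+C \qquad\text{or}\qquad \text{(ii)}\quad B=A+(-C).$$ **Proposition.** Let $A,B\in ck(X)$, and put $s_1:=s(\cdot,A)-s(\cdot,B)$ and $s_2:=s(\cdot,B)-s(\cdot,A)$, as functions on $X^*$. Then exactly one of the following four cases occurs, with the stated conclusion. (a) If $s_1$ and $s_2$ are both bw*-continuous and subadditive, then $A\ominus_g B$ exists in $ck(X)$ and is a singleton. (b) If $s_1$ is bw*-continuous and subadditive and $s_2$ is not both bw*-continuous and subadditive, then $C=A\ominus_g B$ exists, equation (i) holds, and $s(\cdot,C)=s_1$.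 (c) If $s_2$ is bw*-continuous and subadditive and $s_1$ is not both bw*-continuous and subadditive, then $C=A\ominus_g B$ exists, equation (ii) holds, and $s(\cdot,C)=s(\cdot,-B)-s(\cdot,-A)$. (d) If neither $s_1$ nor $s_2$ is both bw*-continuous and subadditive, then $A\ominus_g B$ does not exist. -/

import Mathlib

open scoped Pointwise

noncomputable section

/- For a real Banach space `X`, the hyperspace `ck(X)` of nonempty compact convex subsets of `X`
is Mathlib's `ConvexBody X`, and `X*` is `StrongDual ℝ X`. -/

/-- The opposite `-A = {-a : a ∈ A}` of a nonempty compact convex set. -/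
instance ConvexBody.instNegOpposite {X : Type*} [NormedAddCommGroup X] [NormedSpace ℝ X] :
    Neg (ConvexBody X) where
  neg A := ⟨-(A : Set X), A.convex.neg, A.isCompact.neg, A.nonempty.neg⟩

/-- The support function `s(x*, C) = sup {⟨x*, c⟩ : c ∈ C}`; the supremum is over a nonempty
bounded set of reals since `C` is nonempty and compact. -/
def supportFn {X : Type*} [NormedAddCommGroup X] [NormedSpace ℝ X]
    (C : ConvexBody X) (f : StrongDual ℝ X) : ℝ :=
  sSup ((fun c : X => f c) '' (C : Set X))

/-- The weak-star topology `σ(X*, X)` on `X*`. -/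
@[reducible]
def weakStarTopology (X : Type*) [NormedAddCommGroup X] [NormedSpace ℝ X] :
    TopologicalSpace (StrongDual ℝ X) :=
  TopologicalSpace.induced (StrongDual.toWeakDual : StrongDual ℝ X → WeakDual ℝ X) inferInstance

/-- The bounded-weak-star topology on `X*`: a set is open if and only if its trace on each closed
ball `{f : ‖f‖ ≤ r}` is relatively weak-star open. It is the strongest topology that agrees with
the weak-star topology on each such ball, see `bwStarTopology_isLeast`. -/
@[reducible]
def bwStarTopology (X : Type*) [NormedAddCommGroup X] [NormedSpace ℝ X] :
    TopologicalSpace (StrongDual ℝ X) :=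
  ⨆ r : ℝ, TopologicalSpace.coinduced
    (Subtype.val : Metric.closedBall (0 : StrongDual ℝ X) r → StrongDual ℝ X)
    (TopologicalSpace.induced Subtype.val (weakStarTopology X))

/-- In Mathlib's order on topologies, `t ≤ t'` means that `t` is stronger than `t'`. -/
theorem bwStarTopology_isLeast (X : Type*) [NormedAddCommGroup X] [NormedSpace ℝ X] :
    IsLeast {t : TopologicalSpace (StrongDual ℝ X) |
      ∀ r : ℝ, TopologicalSpace.induced
          (Subtype.val : Metric.closedBall (0 : StrongDual ℝ X) r → StrongDual ℝ X) t =
        TopologicalSpace.induced Subtype.val (weakStarTopology X)} (bwStarTopology X) := by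
  constructor
  · intro r
    apply le_antisymm
    · apply induced_mono
      refine iSup_le fun s => ?_
      rw [← continuous_iff_coinduced_le]
      exact continuous_induced_dom
    · rw [← coinduced_le_iff_le_induced]
      exact le_iSup (fun r : ℝ => TopologicalSpace.coinduced
        (Subtype.val : Metric.closedBall (0 : StrongDual ℝ X) r → StrongDual ℝ X)
        (TopologicalSpace.induced Subtype.val (weakStarTopology X))) r
  · intro t ht
    refine iSup_le fun r => ?_
    rw [coinduced_le_iff_le_induced, ht r]

/-- The function `h : X* → ℝ` is bw*-continuous and subadditive. -/
def IsBwStarContinuousSubadditive {X : Type*} [NormedAddCommGroup X] [NormedSpace ℝ X]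
    (h : StrongDual ℝ X → ℝ) : Prop :=
  @Continuous (StrongDual ℝ X) ℝ (bwStarTopology X) inferInstance h ∧
    ∀ f g : StrongDual ℝ X, h (f + g) ≤ h f + h g

/-- `C` is a generalized Hukuhara difference of `A` and `B`: `A = B + C` or `B = A + (-C)`. -/
def IsGHDifference {X : Type*} [NormedAddCommGroup X] [NormedSpace ℝ X]
    (A B C : ConvexBody X) : Prop :=
  A = B + C ∨ B = A + (-C)

end

/-!
A nonempty compact convex set is determined by its support function, which is additive in the set
and bw*-continuous and sublinear in the functional. So everything reduces to one existence result:
if `h = s(·, A) - s(·, B)` is subadditive, then `h` is the support function of some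
`C ∈ ck(X)`, and then `A = B + C` (`exists_eq_add_of_subadditive`).

The set is `C = {x | ∀ f, f x ≤ h f}`. To see that its support function is `h`, fix `f₀` and use
Hahn–Banach on `X*` to find a linear `φ ≤ h` with `φ f₀ = h f₀`. For `b ∈ B`, the functional
`f ↦ φ f + f b` lies below `s(·, A)`. Since `A` is compact in `X`, its canonical image in the
algebraic dual of `X*` is compact for the topology of pointwise convergence, so a separation
argument shows that any linear functional below `s(·, A)` is the evaluation at a point of `A`
(`exists_mem_eval_eq_of_le_supportFn`). Hence `φ` itself is the evaluation at a point of `C`.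
The same fact for evaluations shows that `C + b ⊆ A`, so that `C` is compact. Neither
completeness of `X` nor continuity of `h` is needed here; bw*-continuity holds for every support
function, because weak* convergence on bounded sets is uniform on compact subsets of `X`
(`continuous_supportFn`).
-/

open Set

section SupportFunction

/-! ### Support functions of compact convex sets -/

variable {X : Type*} [NormedAddCommGroup X] [NormedSpace ℝ X]

theorem ConvexBody.coe_neg (A : ConvexBody X) : ((-A : ConvexBody X) : Set X) = -(A : Set X) :=
  rfl

theorem ConvexBody.neg_neg (A : ConvexBody X) : -(-A) = A := by
  ext1
  simp [ConvexBody.coe_neg]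

theorem le_supportFn (C : ConvexBody X) (f : StrongDual ℝ X) {c : X} (hc : c ∈ C) :
    f c ≤ supportFn C f :=
  le_csSup (C.isCompact.image f.continuous).bddAbove (mem_image_of_mem _ hc)

theorem exists_eq_supportFn (C : ConvexBody X) (f : StrongDual ℝ X) :
    ∃ c ∈ C, f c = supportFn C f :=
  (C.isCompact.image f.continuous).sSup_mem (C.nonempty.image _)

theorem supportFn_le_iff (C : ConvexBody X) (f : StrongDual ℝ X) (t : ℝ) :
    supportFn C f ≤ t ↔ ∀ c ∈ C, f c ≤ t := by
  refine ⟨fun h c hc => (le_supportFn C f hc).trans h, fun h => ?_⟩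
  obtain ⟨c, hc, hcf⟩ := exists_eq_supportFn C f
  exact hcf ▸ h c hc

theorem supportFn_add (A B : ConvexBody X) (f : StrongDual ℝ X) :
    supportFn (A + B) f = supportFn A f + supportFn B f := by
  apply le_antisymm
  · rw [supportFn_le_iff]
    rintro _ ⟨a, ha, b, hb, rfl⟩
    rw [map_add]
    exact add_le_add (le_supportFn A f ha) (le_supportFn B f hb)
  · obtain ⟨a, ha, haf⟩ := exists_eq_supportFn A f
    obtain ⟨b, hb, hbf⟩ := exists_eq_supportFn B f
    rw [← haf, ← hbf, ← map_add]
    exact le_supportFn _ f (Set.add_mem_add ha hb)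

theorem supportFn_neg (A : ConvexBody X) (f : StrongDual ℝ X) :
    supportFn (-A) f = supportFn A (-f) := by
  apply le_antisymm
  · rw [supportFn_le_iff]
    intro c hc
    simpa using le_supportFn A (-f) (c := -c) hc
  · rw [supportFn_le_iff]
    intro c hc
    have hc' : -c ∈ -A := by
      change - -c ∈ A
      simpa using hc
    simpa using le_supportFn (-A) f hc'

theorem supportFn_smul (A : ConvexBody X) {t : ℝ} (ht : 0 < t) (f : StrongDual ℝ X) :
    supportFn A (t • f) = t * supportFn A f := by
  apply le_antisymm
  · rw [supportFn_le_iff]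
    intro c hc
    exact mul_le_mul_of_nonneg_left (le_supportFn A f hc) ht.le
  · obtain ⟨c, hc, hcf⟩ := exists_eq_supportFn A f
    rw [← hcf]
    exact le_supportFn A (t • f) hc

theorem supportFn_subadditive (A : ConvexBody X) (f g : StrongDual ℝ X) :
    supportFn A (f + g) ≤ supportFn A f + supportFn A g := by
  rw [supportFn_le_iff]
  intro c hc
  exact add_le_add (le_supportFn A f hc) (le_supportFn A g hc)

/-- On a ball of radius `r` all functionals are `r`-Lipschitz, which makes the pairing with `X`
jointly continuous for the weak-star topology on the ball; the supremum over a compact set is then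
continuous. -/
theorem continuous_supportFn (C : ConvexBody X) :
    @Continuous (StrongDual ℝ X) ℝ (bwStarTopology X) inferInstance (supportFn C) := by
  rw [continuous_iff_le_induced]
  refine iSup_le fun r => ?_
  rw [← continuous_iff_le_induced, continuous_coinduced_dom]
  let := TopologicalSpace.induced
    (Subtype.val : Metric.closedBall (0 : StrongDual ℝ X) r → StrongDual ℝ X) (weakStarTopology X)
  let F : Metric.closedBall (0 : StrongDual ℝ X) r → X → ℝ := fun f c => f.1 c
  refine IsCompact.continuous_sSup (f := F) C.isCompact ?_
  refine continuous_prod_of_continuous_lipschitzWith' _ r.toNNReal (fun f => ?_) fun c => ?_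
  · refine f.1.lipschitz.weaken ?_
    rw [← NNReal.coe_le_coe, coe_nnnorm]
    exact (mem_closedBall_zero_iff.1 f.2).trans (Real.le_coe_toNNReal r)
  · have h₁ : Continuous fun f : Metric.closedBall (0 : StrongDual ℝ X) r =>
        StrongDual.toWeakDual f.1 := by
      refine continuous_iff_le_induced.2 ?_
      rw [← Function.comp_def, ← induced_compose]
    exact (WeakDual.eval_continuous c).comp h₁

theorem isBwStarContinuousSubadditive_supportFn (C : ConvexBody X) :
    IsBwStarContinuousSubadditive (supportFn C) :=
  ⟨continuous_supportFn C, supportFn_subadditive C⟩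

/-! ### Linear functionals below a support function -/

/-- A compact convex subset of `X` stays compact in the algebraic dual of `X*` with the topology of
pointwise convergence, whose continuous functionals are the evaluations at points of `X*`.
Separation then shows that it captures every linear functional below its support function. -/
theorem exists_mem_eval_eq_of_le_supportFn (A : ConvexBody X) (φ : StrongDual ℝ X →ₗ[ℝ] ℝ)
    (hφ : ∀ f, φ f ≤ supportFn A f) : ∃ a ∈ A, ∀ f, φ f = f a := by
  let P : (StrongDual ℝ X →ₗ[ℝ] ℝ) →ₗ[ℝ] StrongDual ℝ X →ₗ[ℝ] ℝ := LinearMap.id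
  have hP : Topology.IsEmbedding fun (ψ : WeakBilin P) f => P ψ f :=
    WeakBilin.isEmbedding (B := P) Function.injective_id
  have : T2Space (WeakBilin P) := hP.t2Space
  let J : X →ₗ[ℝ] WeakBilin P := (ContinuousLinearMap.coeLM ℝ).flip
  have hJ : Continuous J := WeakBilin.continuous_of_continuous_eval P fun f => f.continuous
  by_contra! hne
  have hmem : (show WeakBilin P from φ) ∉ J '' (A : Set X) := by
    rintro ⟨a, ha, rfl⟩
    obtain ⟨f, hf⟩ := hne a ha
    exact hf rfl
  obtain ⟨ℓ, u, hu, huφ⟩ := geometric_hahn_banach_closed_point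
    (A.convex.is_linear_image J.isLinear) (A.isCompact.image hJ).isClosed hmem
  obtain ⟨f, rfl⟩ := LinearMap.dualEmbedding_surjective P ℓ
  refine (hφ f).not_gt (lt_of_le_of_lt ?_ huφ)
  exact (supportFn_le_iff A f u).2 fun a ha => (hu _ (mem_image_of_mem J ha)).le

theorem mem_of_forall_le_supportFn (A : ConvexBody X) {x : X}
    (hx : ∀ f : StrongDual ℝ X, f x ≤ supportFn A f) : x ∈ A := by
  obtain ⟨a, ha, hax⟩ :=
    exists_mem_eval_eq_of_le_supportFn A ((ContinuousLinearMap.coeLM ℝ).flip x) hx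
  have : x = a := (SeparatingDual.eq_iff_forall_dual_eq (R := ℝ)).2 hax
  exact this ▸ ha

theorem supportFn_injective : Function.Injective (supportFn (X := X)) := by
  intro A B h
  ext x
  exact ⟨fun hx => mem_of_forall_le_supportFn B fun f => h ▸ le_supportFn A f hx,
    fun hx => mem_of_forall_le_supportFn A fun f => h ▸ le_supportFn B f hx⟩

theorem eq_add_iff_supportFn (A B C : ConvexBody X) :
    A = B + C ↔ supportFn C = fun f => supportFn A f - supportFn B f := by
  rw [← supportFn_injective.eq_iff]
  simp only [funext_iff, supportFn_add, eq_sub_iff_add_eq', eq_comm]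

/-- Hahn–Banach: a sublinear functional is attained at a given point by a linear minorant. -/
theorem exists_linearMap_le_eq {E : Type*} [AddCommGroup E] [Module ℝ E] (N : E → ℝ)
    (N_hom : ∀ c : ℝ, 0 < c → ∀ x, N (c • x) = c * N x)
    (N_add : ∀ x y, N (x + y) ≤ N x + N y) (x₀ : E) :
    ∃ φ : E →ₗ[ℝ] ℝ, φ x₀ = N x₀ ∧ ∀ x, φ x ≤ N x := by
  have N_zero : N 0 = 0 := by
    have := N_hom 2 two_pos 0
    rw [smul_zero] at this
    linarith
  have H : ∀ c : ℝ, c • x₀ = 0 → c • N x₀ = 0 := by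
    intro c hc
    rcases smul_eq_zero.1 hc with rfl | rfl
    · simp
    · simp [N_zero]
  let p : E →ₗ.[ℝ] ℝ := LinearPMap.mkSpanSingleton' x₀ (N x₀) H
  have hp : ∀ y : p.domain, p y ≤ N y := by
    rintro ⟨y, hy⟩
    obtain ⟨c, rfl⟩ := Submodule.mem_span_singleton.1 hy
    refine (LinearPMap.mkSpanSingleton'_apply _ _ _ _ _).trans_le ?_
    rcases lt_trichotomy c 0 with hc | rfl | hc
    · have h₁ := N_hom (-c) (neg_pos.2 hc) x₀
      have h₂ := N_add (c • x₀) (-c • x₀)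
      rw [neg_smul, add_neg_cancel, N_zero, ← neg_smul, h₁] at h₂
      simp only [smul_eq_mul, RingHom.id_apply]
      linarith
    · simp [N_zero]
    · simp [N_hom c hc]
  obtain ⟨φ, hφ, hle⟩ := exists_extension_of_le_sublinear p N N_hom N_add hp
  exact ⟨φ, (hφ ⟨x₀, Submodule.mem_span_singleton_self x₀⟩).trans
    (LinearPMap.mkSpanSingleton'_apply_self _ _ _ _), hle⟩

/-! ### Hukuhara differences -/

/-- The Hukuhara difference is `{x | ∀ f, f x ≤ h f}` for the subadditive function
`h = s(·, A) - s(·, B)`. -/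
theorem exists_eq_add_of_subadditive (A B : ConvexBody X)
    (h : ∀ f g : StrongDual ℝ X, supportFn A (f + g) - supportFn B (f + g) ≤
      (supportFn A f - supportFn B f) + (supportFn A g - supportFn B g)) :
    ∃ C : ConvexBody X, A = B + C := by
  let S : Set X := {x | ∀ f : StrongDual ℝ X, f x ≤ supportFn A f - supportFn B f}
  -- Adding a fixed point of `B` to `φ` makes the representation of minorants of `s(·, A)` apply.
  have hS : ∀ f₀ : StrongDual ℝ X, ∃ x ∈ S, f₀ x = supportFn A f₀ - supportFn B f₀ := by
    intro f₀
    obtain ⟨φ, hφ₀, hφ⟩ := exists_linearMap_le_eq (fun f => supportFn A f - supportFn B f)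
      (fun c hc f => by simp only [supportFn_smul _ hc, mul_sub]) h f₀
    obtain ⟨b, hb⟩ := B.nonempty
    obtain ⟨a, -, hab⟩ := exists_mem_eval_eq_of_le_supportFn A
      (φ + (ContinuousLinearMap.coeLM ℝ).flip b) fun f => by
        have h₁ := hφ f
        have h₂ := le_supportFn B f hb
        change φ f + f b ≤ _
        linarith
    have key : ∀ f : StrongDual ℝ X, f (a - b) = φ f := by
      intro f
      rw [map_sub, ← hab f]
      exact add_sub_cancel_right _ _
    exact ⟨a - b, fun f => (key f).trans_le (hφ f), (key f₀).trans hφ₀⟩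
  have hS_convex : Convex ℝ S := by
    simp only [S, ofPred_forall]
    exact convex_iInter fun f => convex_halfSpace_le f.isLinear _
  have hS_closed : IsClosed S := by
    simp only [S, ofPred_forall]
    exact isClosed_iInter fun f => isClosed_le f.continuous continuous_const
  have hS_compact : IsCompact S := by
    obtain ⟨b, hb⟩ := B.nonempty
    refine (A.isCompact.image (continuous_sub_right b)).of_isClosed_subset hS_closed ?_
    intro x hx
    refine ⟨x + b, mem_of_forall_le_supportFn A fun f => ?_, add_sub_cancel_right x b⟩
    have h₁ := hx f
    have h₂ := le_supportFn B f hb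
    rw [map_add]
    linarith
  have hS_nonempty : S.Nonempty := let ⟨x, hx, _⟩ := hS 0; ⟨x, hx⟩
  let C : ConvexBody X := ⟨S, hS_convex, hS_compact, hS_nonempty⟩
  refine ⟨C, (eq_add_iff_supportFn A B C).2 (funext fun f => le_antisymm ?_ ?_)⟩
  · exact (supportFn_le_iff C f _).2 fun x hx => hx f
  · obtain ⟨x, hx, hxf⟩ := hS f
    exact hxf ▸ le_supportFn C f hx

theorem exists_eq_add_iff (A B : ConvexBody X) :
    (∃ C, A = B + C) ↔
      IsBwStarContinuousSubadditive fun f => supportFn A f - supportFn B f := by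
  refine ⟨fun ⟨C, hC⟩ => ?_, fun h => exists_eq_add_of_subadditive A B h.2⟩
  rw [← (eq_add_iff_supportFn A B C).1 hC]
  exact isBwStarContinuousSubadditive_supportFn C

theorem eq_of_eq_add {A B C D : ConvexBody X} (hC : A = B + C) (hD : A = B + D) : C = D :=
  supportFn_injective <|
    ((eq_add_iff_supportFn A B C).1 hC).trans ((eq_add_iff_supportFn A B D).1 hD).symm

theorem ConvexBody.exists_eq_singleton_of_supportFn_neg (C : ConvexBody X)
    (hC : ∀ f, supportFn C (-f) = -supportFn C f) : ∃ c : X, (C : Set X) = {c} := by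
  obtain ⟨c, hc⟩ := C.nonempty
  refine ⟨c, eq_singleton_iff_unique_mem.2 ⟨hc, fun x hx => ?_⟩⟩
  refine (SeparatingDual.eq_iff_forall_dual_eq (R := ℝ)).2 fun f => ?_
  have h₁ := le_supportFn C f hc
  have h₂ := le_supportFn C f hx
  have h₃ := le_supportFn C (-f) hc
  have h₄ := le_supportFn C (-f) hx
  rw [hC] at h₃ h₄
  change -f c ≤ _ at h₃
  change -f x ≤ _ at h₄
  linarith

end SupportFunction

theorem mainTheorem6 {X : Type*} [NormedAddCommGroup X] [NormedSpace ℝ X] [CompleteSpace X]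
    (A B : ConvexBody X) (s₁ s₂ : StrongDual ℝ X → ℝ)
    (hs₁ : s₁ = fun f => supportFn A f - supportFn B f)
    (hs₂ : s₂ = fun f => supportFn B f - supportFn A f) :
    (IsBwStarContinuousSubadditive s₁ ∧ IsBwStarContinuousSubadditive s₂ →
      ∃ C : ConvexBody X, (∀ D : ConvexBody X, IsGHDifference A B D ↔ D = C) ∧
        ∃ c : X, (C : Set X) = {c}) ∧
    (IsBwStarContinuousSubadditive s₁ ∧ ¬ IsBwStarContinuousSubadditive s₂ →
      ∃ C : ConvexBody X, (∀ D : ConvexBody X, IsGHDifference A B D ↔ D = C) ∧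
        A = B + C ∧ ∀ f : StrongDual ℝ X, supportFn C f = s₁ f) ∧
    (¬ IsBwStarContinuousSubadditive s₁ ∧ IsBwStarContinuousSubadditive s₂ →
      ∃ C : ConvexBody X, (∀ D : ConvexBody X, IsGHDifference A B D ↔ D = C) ∧
        B = A + (-C) ∧
        ∀ f : StrongDual ℝ X, supportFn C f = supportFn (-B) f - supportFn (-A) f) ∧
    (¬ IsBwStarContinuousSubadditive s₁ ∧ ¬ IsBwStarContinuousSubadditive s₂ →
      ¬ ∃ C : ConvexBody X, IsGHDifference A B C) := by
  subst hs₁ hs₂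
  simp only [← exists_eq_add_iff]
  refine ⟨?_, ?_, ?_, ?_⟩
  · rintro ⟨⟨C, hC⟩, ⟨E, hE⟩⟩
    have hsC := congrFun ((eq_add_iff_supportFn A B C).1 hC)
    have hsE := congrFun ((eq_add_iff_supportFn B A E).1 hE)
    -- `s(·, E) = -s(·, C)`, and `0 ≤ s(f, K) + s(-f, K)` for every `K`, so `s(·, C)` is odd.
    have hnonneg : ∀ (K : ConvexBody X) (f : StrongDual ℝ X),
        0 ≤ supportFn K f + supportFn K (-f) := by
      intro K f
      obtain ⟨c, hc⟩ := K.nonempty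
      have h₁ := le_supportFn K f hc
      have h₂ := le_supportFn K (-f) hc
      change -f c ≤ _ at h₂
      linarith
    have hodd : ∀ f, supportFn C (-f) = -supportFn C f := by
      intro f
      have h₁ := hnonneg C f
      have h₂ := hnonneg E f
      have h₃ := hsC f
      have h₄ := hsC (-f)
      have h₅ := hsE f
      have h₆ := hsE (-f)
      linarith
    have hEC : E = -C := by
      refine supportFn_injective (funext fun f => ?_)
      rw [supportFn_neg, hodd, hsC, hsE, neg_sub]
    refine ⟨C, fun D => ⟨?_, ?_⟩, C.exists_eq_singleton_of_supportFn_neg hodd⟩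
    · rintro (hD | hD)
      · exact eq_of_eq_add hD hC
      · rw [← D.neg_neg, eq_of_eq_add hD hE, hEC, C.neg_neg]
    · rintro rfl
      exact Or.inl hC
  · rintro ⟨⟨C, hC⟩, h₂⟩
    refine ⟨C, fun D => ⟨?_, ?_⟩, hC, congrFun ((eq_add_iff_supportFn A B C).1 hC)⟩
    · rintro (hD | hD)
      · exact eq_of_eq_add hD hC
      · exact absurd ⟨-D, hD⟩ h₂
    · rintro rfl
      exact Or.inl hC
  · rintro ⟨h₁, ⟨E, hE⟩⟩
    refine ⟨-E, fun D => ⟨?_, ?_⟩, by rwa [E.neg_neg], fun f => ?_⟩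
    · rintro (hD | hD)
      · exact absurd ⟨D, hD⟩ h₁
      · rw [← eq_of_eq_add hD hE, D.neg_neg]
    · rintro rfl
      exact Or.inr (by rwa [E.neg_neg])
    · simp only [supportFn_neg, (eq_add_iff_supportFn B A E).1 hE]
  · rintro ⟨h₁, h₂⟩ ⟨C, hC | hC⟩
    · exact h₁ ⟨C, hC⟩
    · exact h₂ ⟨-C, hC⟩
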